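/- Let $\mathbb{E}$ be a finite-dimensional real inner product space with induced norm $\|\cdot\|$, let $\beta\ge 0$, $\mu>0$, $L>0$, and let $h,R,E:\mathbb{E}\to(-\infty,+\infty]$. Write $\operatorname{dom} f=\{f<+\infty\}$, $f_\beta:=\beta R+E$, $R^*(y):=\sup_x(\langle x,y\rangle-R(x))$, let $\partial R$ be the convex subdifferential and $\operatorname{dom}\partial R=\{x:\partial R(x)\ne\emptyset\}$, and let $$D_h(x,y)=h(x)-h(y)-\langle\nabla h(y),x-y\rangle,\qquad D_R^{q}(x,y)=R(x)-R(y)-\langle q,x-y\rangle\ \ (q\in\partial R(y)),$$ $$\alpha(h)=\inf\{D_h(x,y)/D_h(y,x):x,y\in\operatorname{int}\operatorname{dom}h,\ x\neq y\}.$$ Assume: 1. $h$ is of Legendre type: it is proper, lower semicontinuous (lsc) and convex, $\operatorname{int}\operatorname{dom}h\neq\emptyset$, $h$ is differentiable and strictly convex on $\operatorname{int}\operatorname{dom}h$, and $\|\nabla h(u^k)\|\to\infty$ whenever $u^k\in\operatorname{int}\operatorname{dom}h$ converges to a boundary point of $\operatorname{dom}h$. Moreover, $h$ is strongly convex on $\operatorname{dom}h$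 and $\overline{\operatorname{dom}h}=\operatorname{dom}h$. 2. $R\ge 0$ is proper, lsc and convex, $\operatorname{int}\operatorname{dom}h\subset\operatorname{dom}\partial R$, $\operatorname{dom}R\cap\operatorname{int}\operatorname{dom}h\neq\emptyset$, and for every bounded $U\subset\mathbb{E}$ there is $C>0$ with $\|q\|\le C$ for all $x\in U$, $q\in\partial R(x)$. 3. $E$ is proper and lsc, $\operatorname{dom}h\subset\operatorname{dom}E$, $E$ is differentiable on $\operatorname{int}\operatorname{dom}h$ and continuous on $\operatorname{dom}h$, and $Lh-E$ is convex on $\operatorname{int}\operatorname{dom}h$. ($E$ need not be convex.) 4. $\inf_{\operatorname{dom}h}f_\beta>-\infty$. 5. If $u^k\in\operatorname{int}\operatorname{dom}h$ and $u^k\to z\in\operatorname{dom}h$, then $D_h(z,u^k)\to0$ and $D_R^{q^k}(z,u^k)\to0$ for any $q^k\in\partial R(u^k)$. 6. For $f=h$ and $f=E$: $f$ is differentiable on $\operatorname{int}\operatorname{dom}f$ and $\nabla f$ is Lipschitz continuous on every bounded subset of $\operatorname{int}\operatorname{dom}f$. 7. The function $$F_{\beta,\mu}(x,y)=E(x)+(\beta+\mu)R(x)+\mu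 R^*(y)-\mu\langle x,y\rangle$$ on $\mathbb{E}\times\mathbb{E}$ is a KL function. That is, $\sigma=F_{\beta,\mu}$ is proper and lsc and, with $\partial\sigma$ the limiting subdifferential, for every $s^*$ with $\partial\sigma(s^*)\ne\emptyset$ there are $\eta\in(0,+\infty]$, a neighborhood $U$ of $s^*$ and a continuous concave $\varphi:[0,\eta)\to[0,\infty)$ with $\varphi(0)=0$, $\varphi\in C^1(0,\eta)$ and $\varphi'>0$ on $(0,\eta)$, such that $\varphi'(\sigma(s)-\sigma(s^*))\,\operatorname{dist}(0,\partial\sigma(s))\ge1$ for all $s\in U$ with $\sigma(s^*)<\sigma(s)<\sigma(s^*)+\eta$ (where $\operatorname{dist}(0,\emptyset)=+\infty$). Let $x^0\in\operatorname{int}\operatorname{dom}h$ and $p^0\in\partial R(x^0)$, and let $(x^k,p^k)$ be generated by $$x^{k+1}=\arg\min_x\Big\{\langle\nabla E(x^k),x-x^k\rangle+\beta R(x)+\tfrac1{\delta^k}D_h(x,x^k)+\mu^kD_R^{p^k}(x,x^k)\Big\},$$ $$p^{k+1}=\frac{\mu^k}{\mu^k+\beta}\,p^k-\frac1{\delta^k(\mu^k+\beta)}\big[\nabla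 h(x^{k+1})-\nabla h(x^k)+\delta^k\nabla E(x^k)\big],$$ where, for some $\omega\in(0,1+\alpha(h))$ and some $\tau>0$, for all $k\ge0$, $$0<\delta^k<\frac{1+\alpha(h)-\omega}{L},\qquad \tau<\delta^{k+1}\mu^{k+1}\le\delta^k\mu^k,\qquad \mu^k\ge\mu,$$ and $\sum_{k=0}^\infty(\mu^k-\mu)<\infty$. Assume that the level set $\{x:f_\beta(x)\le f_\beta(x^0)\}$ is bounded. Then $\sum_{k=0}^\infty\|x^{k+1}-x^k\|<\infty$, and $x^k$ converges to a point $x^*\in\operatorname{int}\operatorname{dom}h$ (so that $E$ is differentiable at $x^*$). If $\beta=0$, then $\nabla E(x^*)=0$. If $R^*$ is locally strongly convex (each point of $\operatorname{dom}R^*$ has a ball around it on whose intersection with $\operatorname{dom}R^*$ the function $R^*$ is strongly convex, with a modulus that may depend on the point), then $p^k$ also converges and $0\in\nabla E(x^*)+\beta\,\partial R(x^*)$. -/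

import Mathlib

open Filter Topology
open scoped Gradient InnerProductSpace

noncomputable section

namespace LBreIF

/-! Functions with values in `(-∞, +∞]` are modelled as `EReal`-valued functions; properness
(see `IsProper`) excludes the value `-∞`. -/

/-- The effective domain `dom f = {x | f x < +∞}`. -/
def dom {X : Type*} (f : X → EReal) : Set X := {x | f x < ⊤}

/-- The real-valued representative of `f`; it agrees with `f` wherever `f` is finite. -/
def realPart {X : Type*} (f : X → EReal) : X → ℝ := fun x => (f x).toReal

/-- `f` is proper: it never takes the value `-∞` and it is not identically `+∞`. -/
def IsProper {X : Type*} (f : X → EReal) : Prop := (∀ x, f x ≠ ⊥) ∧ ∃ x, f x ≠ ⊤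

/-- Proper, lower semicontinuous and convex. -/
structure IsProperLscConvex {X : Type*} [NormedAddCommGroup X] [InnerProductSpace ℝ X]
    (f : X → EReal) : Prop where
  proper : IsProper f
  lsc : LowerSemicontinuous f
  convex : ConvexOn ℝ (dom f) (realPart f)

/-- The gradient of (the real-valued representative of) `f`. -/
def grad {X : Type*} [NormedAddCommGroup X] [InnerProductSpace ℝ X] [FiniteDimensional ℝ X]
    (f : X → EReal) (x : X) : X := ∇ (realPart f) x

/-- The subdifferential of convex analysis. -/
def subdiff {X : Type*} [NormedAddCommGroup X] [InnerProductSpace ℝ X]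
    (f : X → EReal) (x : X) : Set X :=
  {v | x ∈ dom f ∧ ∀ z, f x + ((⟪v, z - x⟫_ℝ : ℝ) : EReal) ≤ f z}

/-- `dom ∂f`, the set of points at which the subdifferential is nonempty. -/
def domSubdiff {X : Type*} [NormedAddCommGroup X] [InnerProductSpace ℝ X]
    (f : X → EReal) : Set X := {x | (subdiff f x).Nonempty}

/-- The Fenchel conjugate `f* y = sup_x (⟨x, y⟩ - f x)`. -/
def conj {X : Type*} [NormedAddCommGroup X] [InnerProductSpace ℝ X]
    (f : X → EReal) (y : X) : EReal := ⨆ x, (((⟪x, y⟫_ℝ : ℝ) : EReal) - f x)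

/-- The generalized Bregman distance
`D_f^v(x, y) = f x - f y - ⟨v, x - y⟩`, for a subgradient `v` of `f` at `y`. -/
def genBregman {X : Type*} [NormedAddCommGroup X] [InnerProductSpace ℝ X]
    (f : X → EReal) (v x y : X) : EReal := f x - f y - ((⟪v, x - y⟫_ℝ : ℝ) : EReal)

/-- The Bregman distance `D_h(x, y) = h x - h y - ⟨∇h y, x - y⟩`. -/
def bregman {X : Type*} [NormedAddCommGroup X] [InnerProductSpace ℝ X] [FiniteDimensional ℝ X]
    (h : X → EReal) (x y : X) : EReal := genBregman h (grad h y) x y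

/-- Functions of Legendre type: proper lsc convex, essentially smooth, and strictly convex on the
interior of the domain. -/
structure IsLegendre {X : Type*} [NormedAddCommGroup X] [InnerProductSpace ℝ X]
    [FiniteDimensional ℝ X] (h : X → EReal) : Prop where
  properLscConvex : IsProperLscConvex h
  interior_nonempty : (interior (dom h)).Nonempty
  differentiable : ∀ x ∈ interior (dom h), DifferentiableAt ℝ (realPart h) x
  steep : ∀ (u : ℕ → X) (z : X), (∀ k, u k ∈ interior (dom h)) → z ∈ frontier (dom h) →
    Tendsto u atTop (𝓝 z) → Tendsto (fun k => ‖grad h (u k)‖) atTop atTop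
  strictConvex : StrictConvexOn ℝ (interior (dom h)) (realPart h)

/-- The symmetry coefficient
`α(h) = inf {D_h(x, y) / D_h(y, x) : x, y ∈ int dom h, x ≠ y}`. -/
def symmCoeff {X : Type*} [NormedAddCommGroup X] [InnerProductSpace ℝ X] [FiniteDimensional ℝ X]
    (h : X → EReal) : ℝ :=
  sInf {r | ∃ x ∈ interior (dom h), ∃ y ∈ interior (dom h), x ≠ y ∧
    r = (bregman h x y).toReal / (bregman h y x).toReal}

/-- `f` is strongly convex on its domain. -/
def IsStronglyConvex {X : Type*} [NormedAddCommGroup X] [InnerProductSpace ℝ X]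
    (f : X → EReal) : Prop := ∃ c > 0, StrongConvexOn (dom f) c (realPart f)

/-- `f` is locally strongly convex: near each point of its domain it is strongly convex, with a
modulus that may depend on the point. -/
def IsLocallyStronglyConvex {X : Type*} [NormedAddCommGroup X] [InnerProductSpace ℝ X]
    (f : X → EReal) : Prop :=
  ∀ x ∈ dom f, ∃ r > 0, ∃ c > 0, StrongConvexOn (Metric.ball x r ∩ dom f) c (realPart f)

/-- `f` is differentiable on `int dom f` and its gradient is Lipschitz on each bounded subset of
`int dom f`. -/
def IsLocallyGradLipschitz {X : Type*} [NormedAddCommGroup X] [InnerProductSpace ℝ X]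
    [FiniteDimensional ℝ X] (f : X → EReal) : Prop :=
  (∀ x ∈ interior (dom f), DifferentiableAt ℝ (realPart f) x) ∧
  ∀ U : Set X, Bornology.IsBounded U → U ⊆ interior (dom f) →
    ∃ C > 0, ∀ x ∈ U, ∀ y ∈ U, ‖grad f x - grad f y‖ ≤ C * ‖x - y‖

/-- The subgradients of `R` are uniformly bounded on each bounded set. -/
def HasLocallyBoundedSubgradients {X : Type*} [NormedAddCommGroup X] [InnerProductSpace ℝ X]
    (R : X → EReal) : Prop :=
  ∀ U : Set X, Bornology.IsBounded U → ∃ C > 0, ∀ x ∈ U, ∀ p ∈ subdiff R x, ‖p‖ ≤ C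

/-- If `u k ∈ int dom h` converges to `z ∈ dom h`, then `D_h(z, u k) → 0` and
`D_R(z, u k) → 0`, whichever subgradients of `R` at the points `u k` are used. -/
def BregmanVanish {X : Type*} [NormedAddCommGroup X] [InnerProductSpace ℝ X]
    [FiniteDimensional ℝ X] (h R : X → EReal) : Prop :=
  ∀ (u : ℕ → X) (z : X), (∀ k, u k ∈ interior (dom h)) → z ∈ dom h →
    Tendsto u atTop (𝓝 z) →
      Tendsto (fun k => bregman h z (u k)) atTop (𝓝 0) ∧
      ∀ q : ℕ → X, (∀ k, q k ∈ subdiff R (u k)) →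
        Tendsto (fun k => genBregman R (q k) z (u k)) atTop (𝓝 0)

/-- The objective `f_β = β R + E`. -/
def objective {X : Type*} (E R : X → EReal) (β : ℝ) (x : X) : EReal := (β : EReal) * R x + E x

/-- The standing assumptions on `h`, `R`, `E`, on the parameter `β ≥ 0` and on the constant `L`
of the Lipschitz-like convexity condition. -/
structure BasicAssumption {X : Type*} [NormedAddCommGroup X] [InnerProductSpace ℝ X]
    [FiniteDimensional ℝ X] (h R E : X → EReal) (β L : ℝ) : Prop where
  legendre : IsLegendre h
  R_nonneg : ∀ x, 0 ≤ R x
  R_properLscConvex : IsProperLscConvex R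
  R_domSubdiff : interior (dom h) ⊆ domSubdiff R
  R_dom : (dom R ∩ interior (dom h)).Nonempty
  E_proper : IsProper E
  E_lsc : LowerSemicontinuous E
  E_dom : dom h ⊆ dom E
  E_differentiable : ∀ x ∈ interior (dom h), DifferentiableAt ℝ (realPart E) x
  E_continuousOn : ContinuousOn E (dom h)
  L_pos : 0 < L
  lipschitzLike : ConvexOn ℝ (interior (dom h)) (fun x => L * realPart h x - realPart E x)
  β_nonneg : 0 ≤ β
  bddBelow : ⊥ < ⨅ x ∈ dom h, objective E R β x

/-- The objective of the subproblem solved at an iterate `xk` with subgradient `pk`, step size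
`d` and parameter `m`:
`⟨∇E xk, x - xk⟩ + β R x + (1/d) D_h(x, xk) + m D_R^pk(x, xk)`. -/
def subproblem {X : Type*} [NormedAddCommGroup X] [InnerProductSpace ℝ X]
    [FiniteDimensional ℝ X] (h R E : X → EReal) (β d m : ℝ) (xk pk x : X) : EReal :=
  ((⟪grad E xk, x - xk⟫_ℝ : ℝ) : EReal) + (β : EReal) * R x
    + ((1 / d : ℝ) : EReal) * bregman h x xk + (m : EReal) * genBregman R pk x xk

/-- `(x k, p k)` is generated by the linearized Bregman iteration framework with step sizes
`δ k` and parameters `m k`. -/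
structure IsIteration {X : Type*} [NormedAddCommGroup X] [InnerProductSpace ℝ X]
    [FiniteDimensional ℝ X] (h R E : X → EReal) (β : ℝ) (δ m : ℕ → ℝ) (x p : ℕ → X) : Prop where
  x_zero : x 0 ∈ interior (dom h)
  p_zero : p 0 ∈ subdiff R (x 0)
  x_succ : ∀ k z, subproblem h R E β (δ k) (m k) (x k) (p k) (x (k + 1)) ≤
    subproblem h R E β (δ k) (m k) (x k) (p k) z
  p_succ : ∀ k, p (k + 1) = (m k / (m k + β)) • p k
    - (1 / (δ k * (m k + β))) • (grad h (x (k + 1)) - grad h (x k) + δ k • grad E (x k))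

/-- The surrogate `F(x, y) = E x + (β + μ) R x + μ R* y - μ ⟨x, y⟩` on the Euclidean product. -/
def surrogate {X : Type*} [NormedAddCommGroup X] [InnerProductSpace ℝ X]
    (E R : X → EReal) (β μ : ℝ) (s : WithLp 2 (X × X)) : EReal :=
  E s.fst + ((β + μ : ℝ) : EReal) * R s.fst + (μ : EReal) * conj R s.snd
    - ((μ * ⟪s.fst, s.snd⟫_ℝ : ℝ) : EReal)

/-- The Fréchet (regular) subdifferential. -/
def frechetSubdiff {Y : Type*} [NormedAddCommGroup Y] [InnerProductSpace ℝ Y]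
    (σ : Y → EReal) (x : Y) : Set Y :=
  {v | σ x ≠ ⊥ ∧ σ x ≠ ⊤ ∧ ∀ ε > 0, ∀ᶠ y in 𝓝 x,
    σ x + ((⟪v, y - x⟫_ℝ - ε * ‖y - x‖ : ℝ) : EReal) ≤ σ y}

/-- The limiting (Mordukhovich) subdifferential of a possibly nonconvex function. -/
def limitingSubdiff {Y : Type*} [NormedAddCommGroup Y] [InnerProductSpace ℝ Y]
    (σ : Y → EReal) (x : Y) : Set Y :=
  {v | σ x ≠ ⊥ ∧ σ x ≠ ⊤ ∧ ∃ (u w : ℕ → Y), Tendsto u atTop (𝓝 x) ∧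
    Tendsto (fun k => σ (u k)) atTop (𝓝 (σ x)) ∧
    (∀ k, w k ∈ frechetSubdiff σ (u k)) ∧ Tendsto w atTop (𝓝 v)}

/-- The Kurdyka-Łojasiewicz property of `σ` at `xs`. The distance from `0` to an empty
subdifferential is `+∞`. -/
def HasKLProperty {Y : Type*} [NormedAddCommGroup Y] [InnerProductSpace ℝ Y]
    (σ : Y → EReal) (xs : Y) : Prop :=
  ∃ (η : EReal) (U : Set Y) (φ : ℝ → ℝ), 0 < η ∧ U ∈ 𝓝 xs ∧
    ContinuousOn φ {t : ℝ | 0 ≤ t ∧ (t : EReal) < η} ∧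
    ConcaveOn ℝ {t : ℝ | 0 ≤ t ∧ (t : EReal) < η} φ ∧
    (∀ t : ℝ, 0 ≤ t → (t : EReal) < η → 0 ≤ φ t) ∧
    φ 0 = 0 ∧
    ContDiffOn ℝ 1 φ {t : ℝ | 0 < t ∧ (t : EReal) < η} ∧
    (∀ t : ℝ, 0 < t → (t : EReal) < η → 0 < deriv φ t) ∧
    ∀ z ∈ U, σ xs < σ z → σ z < σ xs + η →
      1 ≤ ENNReal.ofReal (deriv φ ((σ z).toReal - (σ xs).toReal)) *
        Metric.infEDist 0 (limitingSubdiff σ z)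

/-- KL functions: proper lsc functions that have the KL property at each point of `dom ∂σ`. -/
structure IsKLFunction {Y : Type*} [NormedAddCommGroup Y] [InnerProductSpace ℝ Y]
    (σ : Y → EReal) : Prop where
  proper : IsProper σ
  lsc : LowerSemicontinuous σ
  kl : ∀ xs, (limitingSubdiff σ xs).Nonempty → HasKLProperty σ xs

end LBreIF

end

/-! Steepness at the boundary contradicts a gradient that is Lipschitz on bounded sets, so `dom h`
is the whole space (`IsLegendre.dom_eq_univ`). Then `R` and `E` are finite everywhere as well, and
the argument runs on real-valued functions, with no boundary to approach.

The update of `p` is the stationarity condition of the subproblem, so every `p k` is a subgradient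
of `R` at `x k`. Pairing that condition with the step, and using the symmetry coefficient and the
step size bound, gives a decrease of `f_β` by a multiple of the squared step length
(`sufficient_decrease`); the iterates stay in the bounded level set, and the `p k` stay bounded.

The surrogate `F` is evaluated at the pairs `(x (k + 1), p k)`. There Fenchel equality turns it into
`f_β` plus `μ` times a Bregman distance of `R` (`surrogate_eq`), which inherits the decrease, and it
has an explicit subgradient bounded by the step length plus a multiple of `m k - μ`
(`mem_frechetSubdiff_surrogate`). Cluster points of these pairs are critical and share one value, so
a KL argument with summable errors yields finite length (`summable_of_surrogate`, `summable_of_KL`).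

In the limit, `(β + μ) p (k + 1) - μ p k` tends to `-∇E(x*)`. If `β = 0`, the bounded sequence `p`
has convergent increments, whose limit must be `0`. If `R*` is locally strongly convex, `∂R(x*)` is
a singleton (`subdiff_subsingleton`), so `p` converges. -/

namespace LBreIF

/-! ### First-order inequalities for convex functions -/

section Convex

variable {X : Type*} [NormedAddCommGroup X] [InnerProductSpace ℝ X] [FiniteDimensional ℝ X]

theorem hasDerivAt_nonneg_of_le {ψ : ℝ → ℝ} {a : ℝ} (hd : HasDerivAt ψ a 0)
    (hle : ∀ t, 0 < t → t ≤ 1 → ψ 0 ≤ ψ t) : 0 ≤ a := by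
  refine ge_of_tendsto hd.tendsto_slope_zero_right ?_
  filter_upwards [Ioc_mem_nhdsGT (zero_lt_one' ℝ)] with t ht
  have := hle t ht.1 ht.2
  simp only [zero_add, smul_eq_mul]
  exact mul_nonneg (inv_nonneg.2 ht.1.le) (by linarith)

theorem hasDerivAt_line {f : X → ℝ} {g y : X} (hf : HasGradientAt f g y) (d : X) :
    HasDerivAt (fun t : ℝ => f (y + t • d)) ⟪g, d⟫_ℝ 0 := by
  have := hf.hasFDerivAt.hasLineDerivAt d
  simpa [HasLineDerivAt] using this

/-- Along the segment from `y` to `x`, the strongly convex chord bound minus `f` attains its minimum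
over `[0, 1]` at `t = 0`, so its derivative there is nonnegative. -/
theorem strongConvex_gradient_ineq {f : X → ℝ} {c : ℝ} (hc : StrongConvexOn Set.univ c f)
    {g y : X} (hf : HasGradientAt f g y) (x : X) :
    f y + ⟪g, x - y⟫_ℝ + c / 2 * ‖x - y‖ ^ 2 ≤ f x := by
  have h1 := hasDerivAt_line hf (x - y)
  have h2 : HasDerivAt (fun t : ℝ => t * (f x - f y) - t * (1 - t) * (c / 2 * ‖x - y‖ ^ 2)
      - f (y + t • (x - y))) (f x - f y - c / 2 * ‖x - y‖ ^ 2 - ⟪g, x - y⟫_ℝ) 0 := by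
    have h3 : HasDerivAt (fun t : ℝ => t * (f x - f y) - t * (1 - t) * (c / 2 * ‖x - y‖ ^ 2))
        (f x - f y - c / 2 * ‖x - y‖ ^ 2) 0 := by
      have := ((hasDerivAt_id (0 : ℝ)).mul_const (f x - f y)).sub
        (((hasDerivAt_id (0 : ℝ)).mul ((hasDerivAt_id (0 : ℝ)).const_sub 1)).mul_const
          (c / 2 * ‖x - y‖ ^ 2))
      exact this.congr_deriv (by simp)
    exact h3.sub h1
  have := hasDerivAt_nonneg_of_le h2 (fun t ht ht1 => by
    have := hc.2 (Set.mem_univ y) (Set.mem_univ x) (sub_nonneg.2 ht1) ht.le (by ring)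
    have e : (1 - t) • y + t • x = y + t • (x - y) := by module
    rw [e, norm_sub_rev y x] at this
    simp only [smul_eq_mul] at this
    simp only [zero_mul, zero_smul, add_zero]
    linarith)
  linarith

theorem convex_gradient_ineq {f : X → ℝ} (hc : ConvexOn ℝ Set.univ f)
    {g y : X} (hf : HasGradientAt f g y) (x : X) : f y + ⟪g, x - y⟫_ℝ ≤ f x := by
  simpa using strongConvex_gradient_ineq (strongConvexOn_zero.2 hc) hf x

/-- First order optimality for the sum of a convex and a differentiable function. -/
theorem subgradient_of_isMin_add {r S : X → ℝ} {κ : ℝ} (hr : ConvexOn ℝ Set.univ r) (hκ : 0 ≤ κ)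
    {g y : X} (hS : HasGradientAt S g y) (hmin : ∀ z, κ * r y + S y ≤ κ * r z + S z) (z : X) :
    0 ≤ κ * (r z - r y) + ⟪g, z - y⟫_ℝ := by
  -- `r` need not be differentiable, so it is replaced along the segment by its chord, which lies
  -- above it; minimality at `t = 0` survives.
  have h2 : HasDerivAt (fun t : ℝ => t * (κ * (r z - r y)) + S (y + t • (z - y)))
      (κ * (r z - r y) + ⟪g, z - y⟫_ℝ) 0 := by
    have := ((hasDerivAt_id (0 : ℝ)).mul_const (κ * (r z - r y))).add (hasDerivAt_line hS (z - y))
    exact this.congr_deriv (by simp)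
  refine hasDerivAt_nonneg_of_le h2 (fun t ht ht1 => ?_)
  have h3 := hr.2 (Set.mem_univ y) (Set.mem_univ z) (sub_nonneg.2 ht1) ht.le (by ring)
  have e : (1 - t) • y + t • z = y + t • (z - y) := by module
  rw [e] at h3
  simp only [smul_eq_mul] at h3
  have h4 := mul_le_mul_of_nonneg_left h3 hκ
  have h5 := hmin (y + t • (z - y))
  simp only [zero_mul, zero_smul, add_zero, zero_add]
  linarith

end Convex

/-! ### Finite length from the Kurdyka-Łojasiewicz inequality -/

section KL

variable {Y : Type*} [NormedAddCommGroup Y] [InnerProductSpace ℝ Y]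

/-- The KL inequality along a sequence holds with one desingularizing function as soon as all
cluster points in a compact set have the KL property at the same level. -/
theorem exists_uniform_desingularizing {σ : Y → EReal} {s w : ℕ → Y} {v : ℕ → ℝ} {c : ℝ}
    {K : Set Y} (hK : IsCompact K) (hsK : ∀ k, s k ∈ K) (hv : ∀ k, σ (s k) = v k)
    (hvc : Tendsto v atTop (𝓝 c)) (hgt : ∀ k, c < v k)
    (hw : ∀ k, w k ∈ limitingSubdiff σ (s k))
    (hclus : ∀ z, MapClusterPt z atTop s → σ z = c ∧ HasKLProperty σ z) :
    ∃ (η : ℝ) (φ : ℝ → ℝ), 0 < η ∧ ConcaveOn ℝ (Set.Ico 0 η) φ ∧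
      (∀ t ∈ Set.Ico 0 η, 0 ≤ φ t) ∧ (∀ t ∈ Set.Ioo 0 η, 0 < deriv φ t) ∧
      ∀ᶠ k in atTop, 1 ≤ deriv φ (v k - c) * ‖w k‖ := by
  -- Restricting the inequality to indices with `s k` in a given set makes the claim local, so
  -- compactness can glue it from neighbourhoods.
  suffices H : ∃ (η : ℝ) (φ : ℝ → ℝ), 0 < η ∧ ConcaveOn ℝ (Set.Ico 0 η) φ ∧
      (∀ t ∈ Set.Ico 0 η, 0 ≤ φ t) ∧ (∀ t ∈ Set.Ioo 0 η, 0 < deriv φ t) ∧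
      ∀ᶠ k in atTop, s k ∈ K → 1 ≤ deriv φ (v k - c) * ‖w k‖ by
    obtain ⟨η, φ, h1, h2, h3, h4, h5⟩ := H
    exact ⟨η, φ, h1, h2, h3, h4, h5.mono fun k hk => hk (hsK k)⟩
  have hconcave_id : ConcaveOn ℝ (Set.Ico (0 : ℝ) 1) (fun t : ℝ => t) :=
    concaveOn_id (convex_Ico 0 1)
  refine hK.induction_on (p := fun S => ∃ (η : ℝ) (φ : ℝ → ℝ), 0 < η ∧
      ConcaveOn ℝ (Set.Ico 0 η) φ ∧
      (∀ t ∈ Set.Ico 0 η, 0 ≤ φ t) ∧ (∀ t ∈ Set.Ioo 0 η, 0 < deriv φ t) ∧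
      ∀ᶠ k in atTop, s k ∈ S → 1 ≤ deriv φ (v k - c) * ‖w k‖) ?_ ?_ ?_ ?_
  · exact ⟨1, fun t => t, one_pos, hconcave_id, fun t ht => ht.1, fun t _ => by simp, by simp⟩
  · rintro S T hST ⟨η, φ, h1, h2, h3, h4, h5⟩
    exact ⟨η, φ, h1, h2, h3, h4, h5.mono fun k hk hs => hk (hST hs)⟩
  · rintro S T ⟨η, φ, h1, h2, h3, h4, h5⟩ ⟨η', φ', h1', h2', h3', h4', h5'⟩
    have hsub : Set.Ico 0 (min η η') ⊆ Set.Ico 0 η :=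
      Set.Ico_subset_Ico_right (min_le_left _ _)
    have hsub' : Set.Ico 0 (min η η') ⊆ Set.Ico 0 η' :=
      Set.Ico_subset_Ico_right (min_le_right _ _)
    -- On a union the two desingularizing functions are added: each derivative is positive, so the
    -- sum dominates both. Positivity also gives differentiability, since `deriv` is `0` where the
    -- derivative does not exist.
    have hder : ∀ t, 0 < t → t < min η η' → deriv (φ + φ') t = deriv φ t + deriv φ' t :=
      fun t ht ht' => deriv_add
        (differentiableAt_of_deriv_ne_zero (h4 t ⟨ht, ht'.trans_le (min_le_left _ _)⟩).ne')
        (differentiableAt_of_deriv_ne_zero (h4' t ⟨ht, ht'.trans_le (min_le_right _ _)⟩).ne')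
    refine ⟨min η η', φ + φ', lt_min h1 h1',
      (h2.subset hsub (convex_Ico _ _)).add (h2'.subset hsub' (convex_Ico _ _)),
      fun t ht => add_nonneg (h3 t (hsub ht)) (h3' t (hsub' ht)), fun t ht => ?_, ?_⟩
    · rw [hder t ht.1 ht.2]
      exact add_pos (h4 t ⟨ht.1, ht.2.trans_le (min_le_left _ _)⟩)
        (h4' t ⟨ht.1, ht.2.trans_le (min_le_right _ _)⟩)
    · have hlt : ∀ᶠ k in atTop, v k < c + min η η' :=
        hvc.eventually_lt_const (by linarith [lt_min h1 h1'])
      filter_upwards [h5, h5', hlt] with k hk hk' hlt hs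
      have hpos : 0 < v k - c := by linarith [hgt k]
      have hlt' : v k - c < min η η' := by linarith
      rw [hder _ hpos hlt', add_mul]
      have a1 := mul_nonneg (h4 _ ⟨hpos, hlt'.trans_le (min_le_left _ _)⟩).le (norm_nonneg (w k))
      have a2 := mul_nonneg (h4' _ ⟨hpos, hlt'.trans_le (min_le_right _ _)⟩).le
        (norm_nonneg (w k))
      rcases hs with hs | hs
      · linarith [hk hs]
      · linarith [hk' hs]
  · intro z _
    by_cases hz : MapClusterPt z atTop s
    · obtain ⟨hσz, η, U, φ, hη, hU, -, hconc, hnn, -, -, hpos, hkl⟩ := hclus z hz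
      obtain ⟨η', hη'0, hη'⟩ := EReal.lt_iff_exists_real_btwn.1 hη
      have hη'pos : 0 < η' := by exact_mod_cast hη'0
      have hlt_of : ∀ t : ℝ, t < η' → (t : EReal) < η := fun t ht =>
        lt_trans (by exact_mod_cast ht) hη'
      refine ⟨U, mem_nhdsWithin_of_mem_nhds hU, η', φ, hη'pos,
        hconc.subset (fun t ht => ⟨ht.1, hlt_of t ht.2⟩) (convex_Ico _ _),
        fun t ht => hnn t ht.1 (hlt_of t ht.2), fun t ht => hpos t ht.1 (hlt_of t ht.2), ?_⟩
      filter_upwards [hvc.eventually_lt_const (show c < c + η' by linarith)] with k hk hs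
      have h1 := hkl (s k) hs (by rw [hσz, hv]; exact_mod_cast hgt k) (by
        rw [hσz, hv]
        calc (v k : EReal) < ((c + η' : ℝ) : EReal) := by exact_mod_cast hk
          _ ≤ c + η := by
            rw [EReal.coe_add]
            gcongr)
      rw [hσz, hv, EReal.toReal_coe, EReal.toReal_coe] at h1
      have hd : 0 < deriv φ (v k - c) :=
        hpos _ (by linarith [hgt k]) (hlt_of _ (by linarith))
      have h2 : Metric.infEDist 0 (limitingSubdiff σ (s k)) ≤ ENNReal.ofReal ‖w k‖ := by
        refine (Metric.infEDist_le_edist_of_mem (hw k)).trans ?_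
        rw [edist_dist, dist_zero_left]
      have h3 := h1.trans (mul_le_mul_right h2 _)
      rw [← ENNReal.ofReal_mul hd.le] at h3
      exact ENNReal.one_le_ofReal.1 h3
    -- The sequence eventually leaves some neighbourhood of a point that is not a cluster point, so
    -- there the inequality is vacuous.
    · rw [mapClusterPt_iff_frequently] at hz
      push Not at hz
      obtain ⟨V, hV, hV'⟩ := hz
      exact ⟨V, mem_nhdsWithin_of_mem_nhds hV, 1, fun t => t, one_pos, hconcave_id,
        fun t ht => ht.1, fun t _ => by simp, hV'.mono fun k hk hs => absurd hs hk⟩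

theorem concave_gradient_ineq {η : ℝ} {φ : ℝ → ℝ} (hφ : ConcaveOn ℝ (Set.Ico 0 η) φ)
    (hd : ∀ t ∈ Set.Ioo 0 η, 0 < deriv φ t) {t u : ℝ} (hu : 0 ≤ u) (hut : u ≤ t) (ht0 : 0 < t)
    (ht : t < η) : deriv φ t * (t - u) ≤ φ t - φ u := by
  rcases hut.eq_or_lt with rfl | hlt
  · simp
  · have h1 := hφ.le_slope_of_hasDerivAt ⟨hu, hlt.trans ht⟩ ⟨ht0.le, ht⟩ hlt
      (differentiableAt_of_deriv_ne_zero (hd t ⟨ht0, ht⟩).ne').hasDerivAt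
    rw [slope_def_field, le_div_iff₀ (by linarith)] at h1
    exact h1

/-- Summing the recursion, half of the left side cancels the `Δ k` on the right and the `ψ`
differences telescope, which bounds the partial sums. -/
theorem summable_of_eventually_two_mul_le {Δ e ψ : ℕ → ℝ} (hΔ : ∀ k, 0 ≤ Δ k)
    (he0 : ∀ k, 0 ≤ e k) (he : Summable e) {N : ℕ} (hψ : ∀ k ≥ N, 0 ≤ ψ k)
    (hrec : ∀ k ≥ N, 2 * Δ (k + 1) ≤ Δ k + e k + (ψ k - ψ (k + 1))) : Summable Δ := by
  rw [← summable_nat_add_iff N]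
  refine summable_of_sum_range_le (c := Δ N + (∑' k, e (k + N)) + ψ N + Δ N)
    (fun k => hΔ _) (fun n => ?_)
  have he' : Summable fun k => e (k + N) := (summable_nat_add_iff N).2 he
  have key : ∀ n, ∑ k ∈ Finset.range n, Δ (k + N) + 2 * Δ (n + N) + ψ (n + N)
      ≤ 2 * Δ N + ψ N + ∑ k ∈ Finset.range n, e (k + N) := by
    intro n
    induction n with
    | zero => simp
    | succ n ih =>
      have := hrec (n + N) (by omega)
      rw [Finset.sum_range_succ, Finset.sum_range_succ, show n + 1 + N = n + N + 1 by omega]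
      linarith
  have h1 := key n
  have h2 := he'.sum_le_tsum (Finset.range n) (fun k _ => he0 _)
  linarith [hΔ (n + N), hψ (n + N) (by omega)]

/-- Finite length of descent sequences with summable errors under the KL property. -/
theorem summable_of_KL {σ : Y → EReal} {s w : ℕ → Y} {v Δ e : ℕ → ℝ} {a b c : ℝ}
    {K : Set Y} (hK : IsCompact K) (hsK : ∀ k, s k ∈ K) (hv : ∀ k, σ (s k) = v k)
    (hvc : Tendsto v atTop (𝓝 c)) (ha : 0 < a) (hb : 0 < b) (hΔ : ∀ k, 0 ≤ Δ k)
    (he0 : ∀ k, 0 ≤ e k) (he : Summable e)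
    (hdec : ∀ k, v (k + 1) + a * Δ (k + 1) ^ 2 ≤ v k)
    (hw : ∀ k, w k ∈ limitingSubdiff σ (s k)) (hwb : ∀ k, ‖w k‖ ≤ b * Δ k + e k)
    (hclus : ∀ z, MapClusterPt z atTop s → σ z = c ∧ HasKLProperty σ z) : Summable Δ := by
  have hanti : Antitone v := antitone_nat_of_succ_le fun k => by
    have := hdec k
    have : 0 ≤ a * Δ (k + 1) ^ 2 := by positivity
    linarith
  have hcle : ∀ k, c ≤ v k := fun k => hanti.le_of_tendsto hvc k
  by_cases hgt : ∀ k, c < v k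
  · obtain ⟨η, φ, hη, hconc, hnn, hd, hkl⟩ :=
      exists_uniform_desingularizing hK hsK hv hvc hgt hw hclus
    obtain ⟨N, hN⟩ := eventually_atTop.1
      (hkl.and (hvc.eventually_lt_const (show c < c + η by linarith)))
    refine summable_of_eventually_two_mul_le (N := N) (e := fun k => e k / b)
      (ψ := fun k => b / a * φ (v k - c)) hΔ (fun k => div_nonneg (he0 k) hb.le)
      (he.div_const b) (fun k hk => ?_) (fun k hk => ?_)
    · exact mul_nonneg (by positivity)
        (hnn _ ⟨by linarith [hcle k], by linarith [(hN k hk).2]⟩)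
    · obtain ⟨h1, h2⟩ := hN k hk
      -- Concavity turns the decrease of `v` into a decrease of `φ`, and the KL inequality bounds
      -- `φ'` below by `1 / (b * A)`. Hence `Δ (k + 1) ^ 2` is at most a product of `A` and a
      -- telescoping term, which the arithmetic-geometric mean inequality splits.
      have h3 := concave_gradient_ineq hconc hd (u := v (k + 1) - c) (t := v k - c)
        (by linarith [hcle (k + 1)]) (by linarith [hanti (Nat.le_succ k)])
        (by linarith [hgt k]) (by linarith)
      have hdk := hd (v k - c) ⟨by linarith [hgt k], by linarith⟩
      set D := deriv φ (v k - c)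
      set P := φ (v k - c) - φ (v (k + 1) - c)
      set A := Δ k + e k / b with hA
      have hbA : b * Δ k + e k = b * A := by rw [hA]; field_simp
      have h4 : 1 ≤ D * (b * A) :=
        h1.trans (mul_le_mul_of_nonneg_left (hbA ▸ hwb k) hdk.le)
      have hApos : 0 ≤ A := add_nonneg (hΔ k) (div_nonneg (he0 k) hb.le)
      have h5 : D * (a * Δ (k + 1) ^ 2) ≤ P :=
        (mul_le_mul_of_nonneg_left (by linarith [hdec k]) hdk.le).trans h3
      have h6 : a * Δ (k + 1) ^ 2 ≤ b * A * P := by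
        have h7 : 0 ≤ a * Δ (k + 1) ^ 2 := by positivity
        calc a * Δ (k + 1) ^ 2 ≤ (D * (b * A)) * (a * Δ (k + 1) ^ 2) :=
              le_mul_of_one_le_left h7 h4
          _ = (b * A) * (D * (a * Δ (k + 1) ^ 2)) := by ring
          _ ≤ (b * A) * P := mul_le_mul_of_nonneg_left h5 (by positivity)
      have hP : 0 ≤ P := le_trans (by positivity) h5
      have h8 : Δ (k + 1) ^ 2 ≤ A * (b / a * P) := by
        rw [show A * (b / a * P) = b * A * P / a by ring, le_div_iff₀ ha]
        linarith
      have hQ : 0 ≤ b / a * P := by positivity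
      have h9 : 2 * Δ (k + 1) ≤ A + b / a * P := by
        refine abs_le_of_sq_le_sq' ?_ (by positivity) |>.2
        nlinarith [sq_nonneg (A - b / a * P)]
      calc 2 * Δ (k + 1) ≤ A + b / a * P := h9
        _ = _ := by ring
  -- If `v` reaches its limit it is constant afterwards, and the decrease forces all later steps to
  -- vanish.
  · push Not at hgt
    obtain ⟨N, hN⟩ := hgt
    have hconst : ∀ k ≥ N, v k = c := fun k hk => le_antisymm ((hanti hk).trans hN) (hcle k)
    refine summable_of_eventually_two_mul_le (N := N) (e := e) (ψ := fun _ => 0) hΔ he0 he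
      (fun _ _ => le_rfl) (fun k hk => ?_)
    have h1 := hdec k
    rw [hconst k hk, hconst (k + 1) (by omega)] at h1
    have h2 : Δ (k + 1) ^ 2 ≤ 0 := by
      by_contra hne
      push Not at hne
      linarith [mul_pos ha hne]
    have h3 : Δ (k + 1) = 0 := by
      have := le_antisymm h2 (sq_nonneg _)
      simpa using this
    rw [h3]
    linarith [hΔ k, he0 k]

end KL

/-! ### Finiteness everywhere and the symmetry coefficient -/

section Domain

variable {X : Type*} [NormedAddCommGroup X] [InnerProductSpace ℝ X] [FiniteDimensional ℝ X]

/-- A Legendre function whose gradient is Lipschitz on bounded sets is finite everywhere: at a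
boundary point of the domain the gradient would have to blow up. -/
theorem IsLegendre.dom_eq_univ {h : X → EReal} (hL : IsLegendre h)
    (hg : IsLocallyGradLipschitz h) : dom h = Set.univ := by
  by_contra hne
  obtain ⟨z, hz⟩ := nonempty_frontier_iff.2 ⟨hL.interior_nonempty.mono interior_subset, hne⟩
  have hz' : z ∈ closure (interior (dom h)) := by
    rw [hL.properLscConvex.convex.1.closure_interior_eq_closure_of_nonempty_interior
      hL.interior_nonempty]
    exact frontier_subset_closure hz
  obtain ⟨u, hu, hlim⟩ := mem_closure_iff_seq_limit.1 hz'
  have hbdd := Metric.isBounded_range_of_tendsto u hlim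
  obtain ⟨C, hC, hlip⟩ := hg.2 (Set.range u) hbdd (Set.range_subset_iff.2 hu)
  obtain ⟨D, hD⟩ := Metric.isBounded_iff.1 hbdd
  have hle : ∀ k, ‖grad h (u k)‖ ≤ C * D + ‖grad h (u 0)‖ := fun k => by
    have h1 := hlip (u k) ⟨k, rfl⟩ (u 0) ⟨0, rfl⟩
    have h2 := hD (Set.mem_range_self k) (Set.mem_range_self 0)
    rw [dist_eq_norm] at h2
    have h3 := norm_le_norm_sub_add (grad h (u k)) (grad h (u 0))
    have h4 := mul_le_mul_of_nonneg_left h2 hC.le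
    linarith
  obtain ⟨k, hk⟩ := ((hL.steep u z hu hz hlim).eventually_gt_atTop
    (C * D + ‖grad h (u 0)‖)).exists
  exact absurd (hle k) (not_le.2 hk)

theorem eq_coe_realPart {X : Type*} {f : X → EReal} (hbot : ∀ x, f x ≠ ⊥)
    (hdom : dom f = Set.univ) (x : X) : f x = (realPart f x : EReal) :=
  (EReal.coe_toReal (show x ∈ dom f by rw [hdom]; trivial).ne (hbot x)).symm

theorem hasGradientAt_grad {f : X → EReal} (hf : ∀ x, DifferentiableAt ℝ (realPart f) x) (x : X) :
    HasGradientAt (realPart f) (grad f x) x := (hf x).hasGradientAt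

theorem bregman_toReal {h : X → EReal} (hh : ∀ x, h x = (realPart h x : EReal)) (x y : X) :
    (bregman h x y).toReal = realPart h x - realPart h y - ⟪grad h y, x - y⟫_ℝ := by
  rw [bregman, genBregman, hh x, hh y]
  norm_cast

/-- The quadratic lower bound makes the denominators positive for distinct points and all quotients
nonnegative. The latter bounds the set below, which is needed because the real `sInf` of an
unbounded set is a default value. -/
theorem symmCoeff_mul_le {h : X → EReal} (hh : ∀ x, h x = (realPart h x : EReal))
    (hdom : dom h = Set.univ) {c : ℝ} (hc : 0 < c)
    (hbreg : ∀ x y, c * ‖x - y‖ ^ 2 ≤ realPart h x - realPart h y - ⟪grad h y, x - y⟫_ℝ)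
    (x y : X) :
    symmCoeff h * (realPart h y - realPart h x - ⟪grad h x, y - x⟫_ℝ) ≤
      realPart h x - realPart h y - ⟪grad h y, x - y⟫_ℝ := by
  rcases eq_or_ne x y with rfl | hne
  · simp
  have hpos : ∀ x y : X, 0 ≤ realPart h x - realPart h y - ⟪grad h y, x - y⟫_ℝ :=
    fun x y => le_trans (by positivity) (hbreg x y)
  have hyx : 0 < realPart h y - realPart h x - ⟪grad h x, y - x⟫_ℝ := by
    refine lt_of_lt_of_le ?_ (hbreg y x)
    have := norm_pos_iff.2 (sub_ne_zero.2 hne.symm)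
    positivity
  rw [← le_div_iff₀ hyx]
  refine csInf_le ⟨0, ?_⟩ ⟨x, ?_, y, ?_, hne, ?_⟩
  · rintro _ ⟨a, -, b, -, -, rfl⟩
    rw [bregman_toReal hh, bregman_toReal hh]
    exact div_nonneg (hpos _ _) (hpos _ _)
  · simp [hdom]
  · simp [hdom]
  · rw [bregman_toReal hh, bregman_toReal hh]

end Domain

/-! ### One step of the iteration -/

section Step

variable {X : Type*} [NormedAddCommGroup X] [InnerProductSpace ℝ X]

/-- The update of the subgradient variable, in the form of an optimality condition. -/
theorem update_smul_eq {β m d : ℝ} (hβm : m + β ≠ 0) (hd : d ≠ 0) (p u a : X) :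
    (m + β) • ((m / (m + β)) • p - (1 / (d * (m + β))) • (u + d • a)) =
      m • p - (1 / d) • u - a := by
  have h1 : (m + β) * (m / (m + β)) = m := by field_simp
  have h2 : (m + β) * (1 / (d * (m + β))) = 1 / d := by field_simp
  have h3 : 1 / d * d = 1 := by field_simp
  rw [smul_sub, smul_smul, smul_smul, h1, h2, smul_add, smul_smul, h3, one_smul]
  abel

/-- The updated subgradient variable is a subgradient at the new iterate. -/
theorem subgradient_update [FiniteDimensional ℝ X] {H r : X → ℝ} (hr : ConvexOn ℝ Set.univ r) {β m d : ℝ} (hm : 0 < m)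
    (hβ : 0 ≤ β) {gy gx a p q x y : X} (hH : HasGradientAt H gy y)
    (hq : (m + β) • q = m • p - (1 / d) • (gy - gx) - a)
    (hmin : ∀ z, ⟪a, y - x⟫_ℝ + β * r y + 1 / d * (H y - H x - ⟪gx, y - x⟫_ℝ)
        + m * (r y - r x - ⟪p, y - x⟫_ℝ) ≤
      ⟪a, z - x⟫_ℝ + β * r z + 1 / d * (H z - H x - ⟪gx, z - x⟫_ℝ)
        + m * (r z - r x - ⟪p, z - x⟫_ℝ)) (z : X) :
    r y + ⟪q, z - y⟫_ℝ ≤ r z := by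
  have hS : HasGradientAt (fun z => ⟪a - m • p - (1 / d) • gx, z⟫_ℝ + 1 / d * H z)
      (a - m • p - (1 / d) • gx + (1 / d) • gy) y := by
    rw [hasGradientAt_iff_hasFDerivAt, map_add, map_smul]
    refine HasFDerivAt.add ?_ ?_
    · exact (InnerProductSpace.toDual ℝ X (a - m • p - (1 / d) • gx)).hasFDerivAt
    · exact hH.hasFDerivAt.const_mul (1 / d)
  have hκ : 0 < m + β := by linarith
  have h1 := subgradient_of_isMin_add hr hκ.le hS (fun z => by
    have h2 := hmin z
    simp only [inner_sub_left, inner_sub_right, real_inner_smul_left] at h2 ⊢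
    linarith) z
  have h3 : a - m • p - (1 / d) • gx + (1 / d) • gy = -((m + β) • q) := by
    rw [hq]; module
  rw [h3, inner_neg_left, real_inner_smul_left] at h1
  have h4 : 0 ≤ (m + β) * (r z - r y - ⟪q, z - y⟫_ℝ) := by linarith
  linarith [nonneg_of_mul_nonneg_right h4 hκ]

/-- Sufficient decrease of the objective along one step. -/
theorem sufficient_decrease {H r e : X → ℝ} {β m d L α ω c B : ℝ} (hβ : 0 ≤ β) (hm : 0 ≤ m)
    (hd : 0 < d) (hω : 0 < ω) (hc : 0 ≤ c) (hdL : L * d ≤ 1 + α - ω) (hdB : d ≤ B)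
    {gy gx a p q x y : X} (hq : (m + β) • q = m • p - (1 / d) • (gy - gx) - a)
    (hqr : ∀ z, r y + ⟪q, z - y⟫_ℝ ≤ r z)
    (hbreg : c * ‖y - x‖ ^ 2 ≤ H y - H x - ⟪gx, y - x⟫_ℝ)
    (hα : α * (H y - H x - ⟪gx, y - x⟫_ℝ) ≤ H x - H y - ⟪gy, x - y⟫_ℝ)
    (he : e y ≤ e x + ⟪a, y - x⟫_ℝ + L * (H y - H x - ⟪gx, y - x⟫_ℝ)) :
    e y + β * r y + m * (r y - r x - ⟪p, y - x⟫_ℝ) + ω / B * c * ‖y - x‖ ^ 2 ≤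
      e x + β * r x := by
  -- The optimality condition paired with the step `y - x`.
  have h1 : (m + β) * ⟪q, y - x⟫_ℝ = m * ⟪p, y - x⟫_ℝ - 1 / d * (⟪gy, y - x⟫_ℝ - ⟪gx, y - x⟫_ℝ)
      - ⟪a, y - x⟫_ℝ := by
    rw [← real_inner_smul_left, hq, inner_sub_left, inner_sub_left, real_inner_smul_left,
      real_inner_smul_left, inner_sub_left]
  have h2 : ⟪gy, x - y⟫_ℝ = - ⟪gy, y - x⟫_ℝ := by rw [← neg_sub, inner_neg_right]
  have h3 : ⟪q, x - y⟫_ℝ = - ⟪q, y - x⟫_ℝ := by rw [← neg_sub, inner_neg_right]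
  have h4 := hqr x
  rw [h3] at h4
  rw [h2] at hα
  set G := H y - H x - ⟪gx, y - x⟫_ℝ with hG
  have hG0 : 0 ≤ G := le_trans (by positivity) hbreg
  have h5 : (m + β) * (r y - r x - ⟪q, y - x⟫_ℝ) ≤ 0 :=
    mul_nonpos_of_nonneg_of_nonpos (by linarith) (by linarith)
  -- The gradient difference paired with the step is the sum of the two Bregman distances, and the
  -- reverse one is at least `α * G`.
  have h6 : (1 + α) * G ≤ ⟪gy, y - x⟫_ℝ - ⟪gx, y - x⟫_ℝ := by linarith
  have h7 : 1 / d * ((1 + α) * G) ≤ 1 / d * (⟪gy, y - x⟫_ℝ - ⟪gx, y - x⟫_ℝ) :=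
    mul_le_mul_of_nonneg_left h6 (by positivity)
  -- The step size bound leaves a surplus `ω / d` beyond the `L * G` spent on the descent inequality
  -- for `e`.
  have h8 : L * G + ω / d * G ≤ 1 / d * ((1 + α) * G) := by
    have : (L * d + ω) * G ≤ (1 + α) * G := mul_le_mul_of_nonneg_right (by linarith) hG0
    have h9 := mul_le_mul_of_nonneg_left this (show 0 ≤ 1 / d by positivity)
    calc L * G + ω / d * G = 1 / d * ((L * d + ω) * G) := by field_simp
      _ ≤ _ := h9
  have h9 : ω / B * c * ‖y - x‖ ^ 2 ≤ ω / d * G := by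
    have hB : 0 < B := hd.trans_le hdB
    calc ω / B * c * ‖y - x‖ ^ 2 = ω / B * (c * ‖y - x‖ ^ 2) := by ring
      _ ≤ ω / B * G := mul_le_mul_of_nonneg_left hbreg (by positivity)
      _ ≤ ω / d * G := by gcongr
  linarith

end Step

/-! ### Subgradients and the Fenchel conjugate -/

section Conjugate

variable {X : Type*} [NormedAddCommGroup X] [InnerProductSpace ℝ X]

theorem mem_subdiff_iff {R : X → EReal} (hR : ∀ x, R x = (realPart R x : EReal)) {v x : X} :
    v ∈ subdiff R x ↔ ∀ z, realPart R x + ⟪v, z - x⟫_ℝ ≤ realPart R z := by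
  constructor
  · intro hv z
    have := hv.2 z
    rw [hR x, hR z] at this
    exact_mod_cast this
  · refine fun hv => ⟨?_, fun z => ?_⟩
    · change R x < ⊤
      rw [hR x]
      exact EReal.coe_lt_top _
    · rw [hR x, hR z]
      exact_mod_cast hv z

theorem le_conj {R : X → EReal} (hR : ∀ x, R x = (realPart R x : EReal)) (x y : X) :
    ((⟪x, y⟫_ℝ - realPart R x : ℝ) : EReal) ≤ conj R y := by
  refine le_trans (le_of_eq ?_) (le_iSup (fun x => ((⟪x, y⟫_ℝ : ℝ) : EReal) - R x) x)
  simp only [hR x, EReal.coe_sub]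

/-- Equality in the Fenchel-Young inequality. -/
theorem conj_eq_of_mem_subdiff {R : X → EReal} (hR : ∀ x, R x = (realPart R x : EReal))
    {p x : X} (hp : p ∈ subdiff R x) :
    conj R p = ((⟪x, p⟫_ℝ - realPart R x : ℝ) : EReal) := by
  refine le_antisymm (iSup_le fun z => ?_) (le_conj hR x p)
  have := (mem_subdiff_iff hR).1 hp z
  rw [hR z, ← EReal.coe_sub, EReal.coe_le_coe_iff, real_inner_comm, real_inner_comm p x]
  rw [inner_sub_right] at this
  linarith

/-- Local strong convexity of the conjugate forces uniqueness of subgradients. -/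
theorem subdiff_subsingleton {R : X → EReal} (hR : ∀ x, R x = (realPart R x : EReal))
    (hc : IsLocallyStronglyConvex (conj R)) (x : X) : (subdiff R x).Subsingleton := by
  intro p hp q hq
  by_contra hne
  have hdom : ∀ v ∈ subdiff R x, v ∈ dom (conj R) := fun v hv => by
    change conj R v < ⊤
    rw [conj_eq_of_mem_subdiff hR hv]
    exact EReal.coe_lt_top _
  have hval : ∀ v ∈ subdiff R x, realPart (conj R) v = ⟪x, v⟫_ℝ - realPart R x := fun v hv => by
    rw [realPart, conj_eq_of_mem_subdiff hR hv, EReal.toReal_coe]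
  -- The segment between two subgradients stays in `∂R(x)`. By Fenchel equality the conjugate is
  -- affine on it, which strict convexity forbids; `t` below only keeps the second point inside the
  -- ball.
  have hseg : ∀ t : ℝ, 0 ≤ t → t ≤ 1 → p + t • (q - p) ∈ subdiff R x := fun t ht ht1 => by
    rw [mem_subdiff_iff hR] at hp hq ⊢
    intro z
    have h1 := mul_le_mul_of_nonneg_left (hp z) (sub_nonneg.2 ht1)
    have h2 := mul_le_mul_of_nonneg_left (hq z) ht
    rw [inner_add_left, real_inner_smul_left, inner_sub_left]
    linarith
  obtain ⟨ρ, hρ, c, hc0, hsc⟩ := hc p (hdom p hp)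
  have hnorm : 0 < ‖q - p‖ := norm_pos_iff.2 (sub_ne_zero.2 (Ne.symm hne))
  set t := min 1 (ρ / 2 / ‖q - p‖) with ht
  have ht0 : 0 < t := lt_min one_pos (by positivity)
  have ht1 : t ≤ 1 := min_le_left _ _
  have htρ : t * ‖q - p‖ < ρ := by
    have : t * ‖q - p‖ ≤ ρ / 2 := by
      rw [← le_div_iff₀ hnorm]
      exact min_le_right _ _
    linarith
  have hmem := hseg t ht0.le ht1
  have h1 := (hsc.strictConvexOn hc0).2 (x := p) (y := p + t • (q - p))
    ⟨Metric.mem_ball_self hρ, hdom p hp⟩ ⟨by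
      rw [Metric.mem_ball, dist_eq_norm, add_sub_cancel_left, norm_smul, Real.norm_eq_abs,
        abs_of_pos ht0]
      exact htρ, hdom _ hmem⟩
    (by
      intro heq
      have : t • (q - p) = 0 := by simpa using heq.symm
      rcases smul_eq_zero.1 this with h | h
      · exact ht0.ne' h
      · exact hnorm.ne' (by rw [h, norm_zero]))
    (show (0 : ℝ) < 1 / 2 by norm_num) (show (0 : ℝ) < 1 / 2 by norm_num) (by norm_num)
  have hmid : (1 / 2 : ℝ) • p + (1 / 2 : ℝ) • (p + t • (q - p)) = p + (t / 2) • (q - p) := by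
    module
  rw [hmid, hval _ hmem, hval p hp, hval _ (hseg (t / 2) (by linarith) (by linarith))] at h1
  simp only [inner_add_right, real_inner_smul_right, smul_eq_mul] at h1
  linarith

end Conjugate

/-! ### Values and subgradients of the surrogate -/

section Surrogate

variable {X : Type*} [NormedAddCommGroup X] [InnerProductSpace ℝ X]

theorem surrogate_eq {E R : X → EReal} (hE : ∀ x, E x = (realPart E x : EReal))
    (hR : ∀ x, R x = (realPart R x : EReal)) (β μ : ℝ) {p x : X} (hp : p ∈ subdiff R x) (y : X) :
    surrogate E R β μ (WithLp.toLp 2 (y, p)) =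
      ((realPart E y + β * realPart R y
        + μ * (realPart R y - realPart R x - ⟪p, y - x⟫_ℝ) : ℝ) : EReal) := by
  change E y + ((β + μ : ℝ) : EReal) * R y + (μ : EReal) * conj R p
    - ((μ * ⟪y, p⟫_ℝ : ℝ) : EReal) = _
  rw [conj_eq_of_mem_subdiff hR hp, hE y, hR y]
  norm_cast
  rw [inner_sub_right, real_inner_comm p x, real_inner_comm p y]
  ring

theorem le_surrogate {E R : X → EReal} (hE : ∀ x, E x = (realPart E x : EReal))
    (hR : ∀ x, R x = (realPart R x : EReal)) (β : ℝ) {μ : ℝ} (hμ : 0 ≤ μ) (x : X)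
    (s : WithLp 2 (X × X)) :
    ((realPart E s.fst + (β + μ) * realPart R s.fst + μ * (⟪x, s.snd⟫_ℝ - realPart R x)
      - μ * ⟪s.fst, s.snd⟫_ℝ : ℝ) : EReal) ≤ surrogate E R β μ s := by
  rw [surrogate, hE s.fst, hR s.fst]
  simp only [EReal.coe_sub, EReal.coe_add, EReal.coe_mul]
  refine EReal.sub_le_sub (add_le_add le_rfl ?_) le_rfl
  refine mul_le_mul_of_nonneg_left ?_ (by exact_mod_cast hμ)
  have := le_conj hR x s.snd
  rwa [EReal.coe_sub] at this

/-- The conjugate is replaced by its affine minorant coming from `x`, exact at `p`; `R` by its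
minorant at `y` with slope `q`; and `E` by its first-order expansion. What remains is a bilinear
term, quadratic in the displacement. It and the remainder of `E` each take half of `ε`. -/
theorem mem_frechetSubdiff_surrogate [FiniteDimensional ℝ X] {E R : X → EReal}
    (hE : ∀ x, E x = (realPart E x : EReal)) (hR : ∀ x, R x = (realPart R x : EReal))
    {β μ : ℝ} (hβ : 0 ≤ β) (hμ : 0 ≤ μ) {p q x y g : X} (hg : HasGradientAt (realPart E) g y)
    (hp : p ∈ subdiff R x) (hq : q ∈ subdiff R y) :
    WithLp.toLp 2 (g + (β + μ) • q - μ • p, μ • (x - y)) ∈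
      frechetSubdiff (surrogate E R β μ) (WithLp.toLp 2 (y, p)) := by
  refine ⟨?_, ?_, fun ε hε => ?_⟩
  · rw [surrogate_eq hE hR β μ hp]; exact EReal.coe_ne_bot _
  · rw [surrogate_eq hE hR β μ hp]; exact EReal.coe_ne_top _
  have h1 : ∀ᶠ z in 𝓝 y, ‖realPart E z - realPart E y - ⟪g, z - y⟫_ℝ‖ ≤ ε / 2 * ‖z - y‖ :=
    (hasGradientAt_iff_isLittleO.1 hg).def (by positivity)
  have hfst : Tendsto (fun s : WithLp 2 (X × X) => s.fst) (𝓝 (WithLp.toLp 2 (y, p))) (𝓝 y) :=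
    (WithLp.prod_continuous_ofLp 2 X X).fst.tendsto _
  have h2 : ∀ᶠ s : WithLp 2 (X × X) in 𝓝 (WithLp.toLp 2 (y, p)),
      μ * ‖s - WithLp.toLp 2 (y, p)‖ < ε / 2 := by
    have : Tendsto (fun s : WithLp 2 (X × X) => μ * ‖s - WithLp.toLp 2 (y, p)‖)
        (𝓝 (WithLp.toLp 2 (y, p))) (𝓝 (μ * ‖WithLp.toLp 2 (y, p) - WithLp.toLp 2 (y, p)‖)) :=
      ((continuous_id.sub continuous_const).norm.const_mul μ).tendsto _
    rw [sub_self, norm_zero, mul_zero] at this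
    exact this.eventually_lt_const (by positivity)
  filter_upwards [hfst.eventually h1, h2] with s hs1 hs2
  refine le_trans ?_ (le_surrogate hE hR β hμ x s)
  rw [surrogate_eq hE hR β μ hp, ← EReal.coe_add, EReal.coe_le_coe_iff]
  have hr := mul_le_mul_of_nonneg_left ((mem_subdiff_iff hR).1 hq s.fst)
    (show 0 ≤ β + μ by linarith)
  have hn1 : ‖s.fst - y‖ ≤ ‖s - WithLp.toLp 2 (y, p)‖ :=
    WithLp.norm_fst_le X (s - WithLp.toLp 2 (y, p))
  have hn2 : ‖s.snd - p‖ ≤ ‖s - WithLp.toLp 2 (y, p)‖ :=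
    WithLp.norm_snd_le X (s - WithLp.toLp 2 (y, p))
  have hinner : ⟪WithLp.toLp 2 (g + (β + μ) • q - μ • p, μ • (x - y)),
      s - WithLp.toLp 2 (y, p)⟫_ℝ =
      ⟪g + (β + μ) • q - μ • p, s.fst - y⟫_ℝ + ⟪μ • (x - y), s.snd - p⟫_ℝ := by
    rw [WithLp.prod_inner_apply]
    rfl
  rw [hinner]
  set N := ‖s - WithLp.toLp 2 (y, p)‖
  have hN : 0 ≤ N := norm_nonneg _
  have hbil : μ * ⟪s.fst - y, s.snd - p⟫_ℝ ≤ ε / 2 * N := by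
    have h3 := (real_inner_le_norm (s.fst - y) (s.snd - p)).trans
      (mul_le_mul hn1 hn2 (norm_nonneg _) hN)
    calc μ * ⟪s.fst - y, s.snd - p⟫_ℝ ≤ μ * (N * N) := mul_le_mul_of_nonneg_left h3 hμ
      _ = (μ * N) * N := by ring
      _ ≤ ε / 2 * N := mul_le_mul_of_nonneg_right hs2.le hN
  have hE' := (abs_le.1 hs1).1
  have hE'' : ε / 2 * ‖s.fst - y‖ ≤ ε / 2 * N := by gcongr
  simp only [inner_sub_left, inner_sub_right, inner_add_left, real_inner_smul_left] at *
  rw [real_inner_comm p y, real_inner_comm p x] at *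
  rw [real_inner_comm s.fst p] at *
  linarith

theorem frechetSubdiff_subset_limitingSubdiff {Y : Type*} [NormedAddCommGroup Y]
    [InnerProductSpace ℝ Y] (σ : Y → EReal) (x : Y) :
    frechetSubdiff σ x ⊆ limitingSubdiff σ x := fun v hv =>
  ⟨hv.1, hv.2.1, fun _ => x, fun _ => v, tendsto_const_nhds, tendsto_const_nhds, fun _ => hv,
    tendsto_const_nhds⟩

end Surrogate

/-- The Cesàro means of the increments tend to `v`, but they telescope to `(u n - u 0) / n`, which
tends to `0`. -/
theorem eq_zero_of_tendsto_sub_of_bounded {X : Type*} [NormedAddCommGroup X] [NormedSpace ℝ X]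
    {u : ℕ → X} {v : X} {P : ℝ} (hu : ∀ k, ‖u k‖ ≤ P)
    (hv : Tendsto (fun k => u (k + 1) - u k) atTop (𝓝 v)) : v = 0 := by
  have h1 := hv.cesaro_smul
  simp only [Finset.sum_range_sub] at h1
  have h2 : Tendsto (fun n : ℕ => (n : ℝ)⁻¹ * (P + P)) atTop (𝓝 0) := by
    simpa using (tendsto_inv_atTop_nhds_zero_nat (𝕜 := ℝ)).mul_const (P + P)
  refine tendsto_nhds_unique h1 (squeeze_zero_norm (fun n => ?_) h2)
  rw [norm_smul, norm_inv, Real.norm_natCast]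
  exact mul_le_mul_of_nonneg_left ((norm_sub_le _ _).trans (add_le_add (hu n) (hu 0)))
    (by positivity)

/-! ### The iteration in real-valued form -/

section Iteration

variable {X : Type*} [NormedAddCommGroup X] [InnerProductSpace ℝ X] [FiniteDimensional ℝ X]

theorem subproblem_eq {h R E : X → EReal} (hh : ∀ x, h x = (realPart h x : EReal))
    (hR : ∀ x, R x = (realPart R x : EReal)) (β d m : ℝ) (xk pk z : X) :
    subproblem h R E β d m xk pk z = ((⟪grad E xk, z - xk⟫_ℝ + β * realPart R z
      + 1 / d * (realPart h z - realPart h xk - ⟪grad h xk, z - xk⟫_ℝ)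
      + m * (realPart R z - realPart R xk - ⟪pk, z - xk⟫_ℝ) : ℝ) : EReal) := by
  rw [subproblem, bregman, genBregman, genBregman, hh z, hh xk, hR z, hR xk]
  norm_cast

theorem objective_eq {X : Type*} {E R : X → EReal} (hE : ∀ x, E x = (realPart E x : EReal))
    (hR : ∀ x, R x = (realPart R x : EReal)) (β : ℝ) (z : X) :
    objective E R β z = ((realPart E z + β * realPart R z : ℝ) : EReal) := by
  rw [objective, hE z, hR z, add_comm]
  norm_cast

theorem IsIteration.smul_p_succ {h R E : X → EReal} {β : ℝ} {δ m : ℕ → ℝ} {x p : ℕ → X}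
    (hiter : IsIteration h R E β δ m x p) (hβ : 0 ≤ β) (hδ : ∀ k, 0 < δ k) (hm : ∀ k, 0 < m k)
    (k : ℕ) : (m k + β) • p (k + 1) = m k • p k
      - (1 / δ k) • (grad h (x (k + 1)) - grad h (x k)) - grad E (x k) := by
  rw [hiter.p_succ k]
  exact update_smul_eq (by linarith [hm k]) (hδ k).ne' _ _ _

/-- The previous `p k` enters the subproblem only through a linear term, so the successor case needs
no induction hypothesis. -/
theorem IsIteration.mem_subdiff {h R E : X → EReal} {β : ℝ} {δ m : ℕ → ℝ} {x p : ℕ → X}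
    (hiter : IsIteration h R E β δ m x p) (hβ : 0 ≤ β) (hδ : ∀ k, 0 < δ k) (hm : ∀ k, 0 < m k)
    (hh : ∀ x, h x = (realPart h x : EReal)) (hR : ∀ x, R x = (realPart R x : EReal))
    (hdiff : ∀ x, DifferentiableAt ℝ (realPart h) x) (hRc : ConvexOn ℝ Set.univ (realPart R))
    (k : ℕ) : p k ∈ subdiff R (x k) := by
  cases k with
  | zero => exact hiter.p_zero
  | succ k =>
    refine (mem_subdiff_iff hR).2 (subgradient_update (x := x k) hRc (hm k) hβ
      (hasGradientAt_grad hdiff (x (k + 1))) (hiter.smul_p_succ hβ hδ hm k) fun z => ?_)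
    have := hiter.x_succ k z
    rw [subproblem_eq hh hR, subproblem_eq hh hR] at this
    exact_mod_cast this

end Iteration

/-! ### Finite length and convergence of subgradients -/

section Convergence

variable {X : Type*} [NormedAddCommGroup X] [InnerProductSpace ℝ X]

theorem mem_subdiff_of_tendsto {R : X → EReal} (hR : ∀ x, R x = (realPart R x : EReal))
    (hcont : Continuous (realPart R)) {u q : ℕ → X} {y v : X} (hu : Tendsto u atTop (𝓝 y))
    (hq : Tendsto q atTop (𝓝 v)) (hmem : ∀ k, q k ∈ subdiff R (u k)) : v ∈ subdiff R y := by
  rw [mem_subdiff_iff hR]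
  intro z
  refine le_of_tendsto (((hcont.tendsto y).comp hu).add (hq.inner (hu.const_sub z)))
    (Eventually.of_forall fun k => ?_)
  exact (mem_subdiff_iff hR).1 (hmem k) z

theorem norm_toLp_le {X : Type*} [NormedAddCommGroup X] (a b : X) : ‖WithLp.toLp 2 (a, b)‖ ≤ ‖a‖ + ‖b‖ := by
  rw [WithLp.prod_norm_eq_of_L2, Real.sqrt_le_left (by positivity)]
  change ‖a‖ ^ 2 + ‖b‖ ^ 2 ≤ _
  nlinarith [norm_nonneg a, norm_nonneg b]

variable [FiniteDimensional ℝ X]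

/-- Finite length of the iterates, from the KL property of the surrogate, sufficient decrease of
the objective, and a relative error condition with summable errors. -/
theorem summable_of_surrogate {E R : X → EReal} (hE : ∀ x, E x = (realPart E x : EReal))
    (hR : ∀ x, R x = (realPart R x : EReal)) (hdiff : ∀ x, DifferentiableAt ℝ (realPart E) x)
    (hRcont : Continuous (realPart R)) {β μ A b M P lb : ℝ} (hβ : 0 ≤ β) (hμ : 0 < μ)
    (hA : 0 < A) (hb : 0 ≤ b) {m e : ℕ → ℝ} {x p : ℕ → X} (hp : ∀ k, p k ∈ subdiff R (x k))
    (hxM : ∀ k, ‖x k‖ ≤ M) (hpP : ∀ k, ‖p k‖ ≤ P) (hm : ∀ k, μ ≤ m k)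
    (hlb : ∀ z, lb ≤ realPart E z + β * realPart R z)
    (hdec : ∀ k, realPart E (x (k + 1)) + β * realPart R (x (k + 1))
      + m k * (realPart R (x (k + 1)) - realPart R (x k) - ⟪p k, x (k + 1) - x k⟫_ℝ)
      + A * ‖x (k + 1) - x k‖ ^ 2 ≤ realPart E (x k) + β * realPart R (x k))
    (he0 : ∀ k, 0 ≤ e k) (he : Summable e)
    (hwb : ∀ k, ‖grad E (x (k + 1)) + (β + μ) • p (k + 1) - μ • p k‖ ≤
      b * ‖x (k + 1) - x k‖ + e k)
    (hKL : IsKLFunction (surrogate E R β μ)) : Summable fun k => ‖x (k + 1) - x k‖ := by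
  have hD : ∀ k, 0 ≤ realPart R (x (k + 1)) - realPart R (x k) - ⟪p k, x (k + 1) - x k⟫_ℝ :=
    fun k => by linarith [(mem_subdiff_iff hR).1 (hp k) (x (k + 1))]
  -- The index shift matters: with `p k` a subgradient at `x k`, the surrogate at `(x (k + 1), p k)`
  -- contains the Bregman distance of the current step.
  set s : ℕ → WithLp 2 (X × X) := fun k => WithLp.toLp 2 (x (k + 1), p k) with hs
  set w : ℕ → WithLp 2 (X × X) := fun k => WithLp.toLp 2
    (grad E (x (k + 1)) + (β + μ) • p (k + 1) - μ • p k, μ • (x k - x (k + 1))) with hw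
  set v : ℕ → ℝ := fun k => realPart E (x (k + 1)) + β * realPart R (x (k + 1))
    + μ * (realPart R (x (k + 1)) - realPart R (x k) - ⟪p k, x (k + 1) - x k⟫_ℝ) with hvdef
  have hv : ∀ k, surrogate E R β μ (s k) = v k := fun k => surrogate_eq hE hR β μ (hp k) _
  -- The distance at step `k + 1` is controlled by `hdec` because `μ ≤ m (k + 1)`, and the one in `v
  -- k` is dropped as nonnegative.
  have hvdec : ∀ k, v (k + 1) + A * ‖x (k + 1 + 1) - x (k + 1)‖ ^ 2 ≤ v k := fun k => by
    have h1 := hdec (k + 1)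
    have h2 := mul_le_mul_of_nonneg_right (hm (k + 1)) (hD (k + 1))
    have h3 := mul_nonneg hμ.le (hD k)
    simp only [hvdef]
    linarith
  have hanti : Antitone v := antitone_nat_of_succ_le fun k => by
    have : 0 ≤ A * ‖x (k + 1 + 1) - x (k + 1)‖ ^ 2 := by positivity
    linarith [hvdec k]
  have hvc := tendsto_atTop_ciInf hanti ⟨lb, by
    rintro _ ⟨k, rfl⟩
    have := mul_nonneg hμ.le (hD k)
    simp only [hvdef]
    linarith [hlb (x (k + 1))]⟩
  set c := ⨅ k, v k
  have hwfre : ∀ k, w k ∈ frechetSubdiff (surrogate E R β μ) (s k) := fun k =>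
    mem_frechetSubdiff_surrogate hE hR hβ hμ.le (hasGradientAt_grad hdiff _) (hp k) (hp (k + 1))
  have hwle : ∀ k, ‖w k‖ ≤ (b + μ) * ‖x (k + 1) - x k‖ + e k := fun k => by
    refine (norm_toLp_le _ _).trans ?_
    rw [norm_smul, Real.norm_eq_abs, abs_of_pos hμ, norm_sub_rev (x k)]
    linarith [hwb k]
  have hΔ : Tendsto (fun k => ‖x (k + 1) - x k‖) atTop (𝓝 0) := by
    rw [← tendsto_add_atTop_iff_nat 1]
    have h1 : Tendsto (fun k => √((v k - v (k + 1)) / A)) atTop (𝓝 0) := by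
      have := ((hvc.sub (hvc.comp (tendsto_add_atTop_nat 1))).div_const A).sqrt
      simpa using this
    refine squeeze_zero (fun k => norm_nonneg _) (fun k => ?_) h1
    refine Real.le_sqrt_of_sq_le ?_
    rw [le_div_iff₀ hA]
    linarith [hvdec k]
  have hw0 : Tendsto w atTop (𝓝 0) := by
    refine squeeze_zero_norm hwle ?_
    simpa using (hΔ.const_mul (b + μ)).add he.tendsto_atTop_zero
  have hxdiff : Tendsto (fun k => x (k + 1) - x k) atTop (𝓝 0) :=
    tendsto_zero_iff_norm_tendsto_zero.2 hΔ
  refine summable_of_KL (K := Metric.closedBall 0 (M + P)) (isCompact_closedBall _ _) (fun k => ?_)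
    hv hvc hA (show 0 < b + μ by linarith) (fun k => norm_nonneg _) he0 he hvdec
    (fun k => frechetSubdiff_subset_limitingSubdiff _ _ (hwfre k)) hwle (fun z hz => ?_)
  · rw [mem_closedBall_zero_iff]
    exact (norm_toLp_le _ _).trans (add_le_add (hxM _) (hpP _))
  -- Steps tend to `0`, so `x (φ k)` and `x (φ k + 1)` share their limit and the Bregman term
  -- vanishes there: the value at `z` is `c`. Since `w` tends to `0`, `z` is a critical point and
  -- the KL hypothesis applies.
  · obtain ⟨φ, hφ, hlim⟩ := hz.tendsto_subseq
    have hx1 : Tendsto (fun k => x (φ k + 1)) atTop (𝓝 z.fst) :=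
      ((WithLp.prod_continuous_ofLp 2 X X).fst.tendsto z).comp hlim
    have hp1 : Tendsto (fun k => p (φ k)) atTop (𝓝 z.snd) :=
      ((WithLp.prod_continuous_ofLp 2 X X).snd.tendsto z).comp hlim
    have hx0 : Tendsto (fun k => x (φ k)) atTop (𝓝 z.fst) := by
      simpa using hx1.sub (hxdiff.comp hφ.tendsto_atTop)
    have hmem : z.snd ∈ subdiff R z.fst :=
      mem_subdiff_of_tendsto hR hRcont hx0 hp1 fun k => hp _
    have hσz : surrogate E R β μ z =
        ((realPart E z.fst + β * realPart R z.fst : ℝ) : EReal) := by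
      have h1 := surrogate_eq hE hR β μ hmem z.fst
      rw [sub_self, sub_self, inner_zero_right, sub_zero, mul_zero, add_zero] at h1
      exact h1
    have hEcont : Continuous (realPart E) :=
      continuous_iff_continuousAt.2 fun y => (hdiff y).continuousAt
    have hvlim : Tendsto (fun k => v (φ k)) atTop
        (𝓝 (realPart E z.fst + β * realPart R z.fst)) := by
      have hR1 := (hRcont.tendsto z.fst).comp hx1
      have h1 := (((hEcont.tendsto z.fst).comp hx1).add (hR1.const_mul β)).add
        (((hR1.sub ((hRcont.tendsto z.fst).comp hx0)).sub
          (hp1.inner (hx1.sub hx0))).const_mul μ)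
      simpa using h1
    have hc : realPart E z.fst + β * realPart R z.fst = c :=
      tendsto_nhds_unique hvlim (hvc.comp hφ.tendsto_atTop)
    refine ⟨by rw [hσz, hc], hKL.kl z ⟨0, ?_, ?_, fun k => s (φ k), fun k => w (φ k), hlim, ?_,
      fun k => hwfre _, hw0.comp hφ.tendsto_atTop⟩⟩
    · rw [hσz]; exact EReal.coe_ne_bot _
    · rw [hσz]; exact EReal.coe_ne_top _
    · simp only [hv, hσz]
      exact (continuous_coe_real_ereal.tendsto _).comp hvlim

/-- A bounded sequence of subgradients along a convergent sequence converges when subgradients at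
the limit are unique. -/
theorem exists_tendsto_of_subdiff_subsingleton {R : X → EReal}
    (hR : ∀ x, R x = (realPart R x : EReal)) (hcont : Continuous (realPart R)) {x p : ℕ → X}
    {xs : X} {P : ℝ} (hx : Tendsto x atTop (𝓝 xs)) (hp : ∀ k, p k ∈ subdiff R (x k))
    (hpP : ∀ k, ‖p k‖ ≤ P) (hss : (subdiff R xs).Subsingleton) :
    ∃ ps ∈ subdiff R xs, Tendsto p atTop (𝓝 ps) := by
  have hmem : ∀ k, p k ∈ Metric.closedBall (0 : X) P := fun k => by simpa using hpP k
  have hcl : ∀ q, MapClusterPt q atTop p → q ∈ subdiff R xs := fun q hq => by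
    obtain ⟨φ, hφ, hlim⟩ := hq.tendsto_subseq
    exact mem_subdiff_of_tendsto hR hcont (hx.comp hφ.tendsto_atTop) hlim fun k => hp _
  obtain ⟨ps, -, φ, hφ, hlim⟩ := tendsto_subseq_of_bounded Metric.isBounded_closedBall hmem
  have hps : ps ∈ subdiff R xs :=
    mem_subdiff_of_tendsto hR hcont (hx.comp hφ.tendsto_atTop) hlim fun k => hp _
  exact ⟨ps, hps, (isCompact_closedBall (0 : X) P).tendsto_nhds_of_unique_mapClusterPt
    (Eventually.of_forall hmem) fun q _ hq => hss (hcl q hq) hps⟩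

end Convergence

end LBreIF

/-! ### The main theorem -/

theorem theorem4p2 {X : Type*} [NormedAddCommGroup X] [InnerProductSpace ℝ X]
    [FiniteDimensional ℝ X]
    (h R E : X → EReal) (β μ L : ℝ) (δ m : ℕ → ℝ) (x p : ℕ → X)
    (hbasic : LBreIF.BasicAssumption h R E β L)
    (hvanish : LBreIF.BregmanVanish h R)
    (hsub : LBreIF.HasLocallyBoundedSubgradients R)
    (hgrad_h : LBreIF.IsLocallyGradLipschitz h)
    (hgrad_E : LBreIF.IsLocallyGradLipschitz E)
    (hKL : LBreIF.IsKLFunction (LBreIF.surrogate E R β μ))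
    (hstrong : LBreIF.IsStronglyConvex h)
    (hclosed : closure (LBreIF.dom h) = LBreIF.dom h)
    (hlevel : Bornology.IsBounded
      {z : X | LBreIF.objective E R β z ≤ LBreIF.objective E R β (x 0)})
    (hδ : ∃ ω : ℝ, 0 < ω ∧ ω < 1 + LBreIF.symmCoeff h ∧
      ∀ k, 0 < δ k ∧ δ k < (1 + LBreIF.symmCoeff h - ω) / L)
    (hδm : ∃ τ : ℝ, 0 < τ ∧ ∀ k, τ < δ (k + 1) * m (k + 1) ∧
      δ (k + 1) * m (k + 1) ≤ δ k * m k)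
    (hμ : 0 < μ) (hm : ∀ k, μ ≤ m k) (hsum : Summable (fun k => m k - μ))
    (hiter : LBreIF.IsIteration h R E β δ m x p) :
    Summable (fun k => ‖x (k + 1) - x k‖) ∧
    ∃ xs ∈ interior (LBreIF.dom h), Filter.Tendsto x Filter.atTop (nhds xs) ∧
      (β = 0 → LBreIF.grad E xs = 0) ∧
      (LBreIF.IsLocallyStronglyConvex (LBreIF.conj R) →
        (∃ ps : X, Filter.Tendsto p Filter.atTop (nhds ps)) ∧
        ∃ q ∈ LBreIF.subdiff R xs, LBreIF.grad E xs + β • q = 0) := by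
  open LBreIF in
  obtain ⟨ω, hω, hωα, hδk⟩ := hδ
  obtain ⟨τ, hτ, hδm⟩ := hδm
  obtain ⟨c, hc, hsc⟩ := hstrong
  have hβ := hbasic.β_nonneg
  have hLpos := hbasic.L_pos
  -- all the functions are finite everywhere
  have hdomh : dom h = Set.univ := hbasic.legendre.dom_eq_univ hgrad_h
  have hint : interior (dom h) = Set.univ := by rw [hdomh, interior_univ]
  have hdomE : dom E = Set.univ := Set.univ_subset_iff.1 (hdomh ▸ hbasic.E_dom)
  have hdomR : dom R = Set.univ := Set.univ_subset_iff.1 fun z _ => by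
    obtain ⟨q, hq⟩ := hbasic.R_domSubdiff (hint ▸ Set.mem_univ z)
    exact hq.1
  have hh : ∀ z, h z = (realPart h z : EReal) :=
    eq_coe_realPart hbasic.legendre.properLscConvex.proper.1 hdomh
  have hE : ∀ z, E z = (realPart E z : EReal) := eq_coe_realPart hbasic.E_proper.1 hdomE
  have hR : ∀ z, R z = (realPart R z : EReal) :=
    eq_coe_realPart hbasic.R_properLscConvex.proper.1 hdomR
  have hhdiff : ∀ z, DifferentiableAt ℝ (realPart h) z := fun z =>
    hbasic.legendre.differentiable z (hint ▸ Set.mem_univ z)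
  have hEdiff : ∀ z, DifferentiableAt ℝ (realPart E) z := fun z =>
    hbasic.E_differentiable z (hint ▸ Set.mem_univ z)
  have hRconv : ConvexOn ℝ Set.univ (realPart R) := hdomR ▸ hbasic.R_properLscConvex.convex
  have hRcont : Continuous (realPart R) := hRconv.locallyLipschitz.continuous
  rw [hdomh] at hsc
  have hLE := hbasic.lipschitzLike
  rw [hint] at hLE ⊢
  have hmpos : ∀ k, 0 < m k := fun k => hμ.trans_le (hm k)
  have hδpos : ∀ k, 0 < δ k := fun k => (hδk k).1
  have hp := hiter.mem_subdiff hβ hδpos hmpos hh hR hhdiff hRconv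
  have hupd := hiter.smul_p_succ hβ hδpos hmpos
  -- sufficient decrease
  have hbreg : ∀ z y, c / 2 * ‖z - y‖ ^ 2 ≤
      realPart h z - realPart h y - ⟪grad h y, z - y⟫_ℝ := fun z y => by
    linarith [strongConvex_gradient_ineq hsc (hasGradientAt_grad hhdiff y) z]
  -- The gradient inequality for the convex function `L h - E` is a descent lemma with `D_h` in
  -- place of the squared norm.
  have hdescE : ∀ z y, realPart E z ≤ realPart E y + ⟪grad E y, z - y⟫_ℝ
      + L * (realPart h z - realPart h y - ⟪grad h y, z - y⟫_ℝ) := fun z y => by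
    have hg : HasGradientAt (fun z => L * realPart h z - realPart E z)
        (L • grad h y - grad E y) y := by
      rw [hasGradientAt_iff_hasFDerivAt, map_sub, map_smul]
      exact ((hasGradientAt_grad hhdiff y).hasFDerivAt.const_mul L).sub
        (hasGradientAt_grad hEdiff y).hasFDerivAt
    have := convex_gradient_ineq hLE hg z
    rw [inner_sub_left, real_inner_smul_left] at this
    linarith
  set B := (1 + symmCoeff h - ω) / L with hB
  have hBpos : 0 < B := (hδpos 0).trans (hδk 0).2
  set A := ω / B * (c / 2) with hAdef
  have hA : 0 < A := by positivity
  have hdec : ∀ k, realPart E (x (k + 1)) + β * realPart R (x (k + 1))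
      + m k * (realPart R (x (k + 1)) - realPart R (x k) - ⟪p k, x (k + 1) - x k⟫_ℝ)
      + A * ‖x (k + 1) - x k‖ ^ 2 ≤ realPart E (x k) + β * realPart R (x k) := fun k =>
    sufficient_decrease hβ (hmpos k).le (hδpos k) hω (by positivity)
      (by
        have := (lt_div_iff₀ hLpos).1 (hδk k).2
        linarith) (hδk k).2.le (hupd k)
      ((mem_subdiff_iff hR).1 (hp (k + 1))) (hbreg _ _)
      (symmCoeff_mul_le hh hdomh (by positivity) hbreg _ _) (hdescE _ _)
  -- boundedness of the iterates and of the subgradients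
  have hmono : Antitone fun k => realPart E (x k) + β * realPart R (x k) :=
    antitone_nat_of_succ_le fun k => by
      have h1 : 0 ≤ A * ‖x (k + 1) - x k‖ ^ 2 := by positivity
      have h2 := mul_nonneg (hmpos k).le (sub_nonneg.2 (show ⟪p k, x (k + 1) - x k⟫_ℝ ≤
        realPart R (x (k + 1)) - realPart R (x k) by
          linarith [(mem_subdiff_iff hR).1 (hp k) (x (k + 1))]))
      linarith [hdec k]
  obtain ⟨M, hM⟩ := hlevel.exists_norm_le
  have hxM : ∀ k, ‖x k‖ ≤ M := fun k => hM _ (by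
    rw [Set.mem_ofPred_eq, objective_eq hE hR, objective_eq hE hR]
    exact_mod_cast hmono (Nat.zero_le k))
  have hball : Bornology.IsBounded (Metric.closedBall (0 : X) M) := Metric.isBounded_closedBall
  have hxball : ∀ k, x k ∈ Metric.closedBall (0 : X) M := fun k => by simpa using hxM k
  obtain ⟨P, hP, hPb⟩ := hsub _ hball
  have hpP : ∀ k, ‖p k‖ ≤ P := fun k => hPb _ (hxball k) _ (hp k)
  obtain ⟨Ch, hCh, hlipH⟩ := hgrad_h.2 _ hball (by rw [hint]; exact Set.subset_univ _)
  obtain ⟨CE, hCE, hlipE⟩ := hgrad_E.2 _ hball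
    (by rw [hdomE, interior_univ]; exact Set.subset_univ _)
  -- the step sizes are bounded away from zero
  obtain ⟨T, hT⟩ : ∃ T, ∀ k, 1 / δ k ≤ T := by
    -- Since `δ k * m k ≥ τ`, it suffices to bound `m k`, and one excess `m k - μ` is at most the
    -- sum of all. The strict bound by `τ` is given only at successors; index `0` follows by
    -- monotonicity.
    refine ⟨(μ + ∑' k, (m k - μ)) / τ, fun k => ?_⟩
    have h1 : m k ≤ μ + ∑' k, (m k - μ) := by
      linarith [hsum.le_tsum k fun j _ => sub_nonneg.2 (hm j)]
    have h2 : τ ≤ δ k * m k := by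
      cases k with
      | zero => exact (hδm 0).1.le.trans (hδm 0).2
      | succ k => exact (hδm k).1.le
    rw [div_le_div_iff₀ (hδpos k) hτ, one_mul]
    nlinarith [mul_le_mul_of_nonneg_left h1 (hδpos k).le]
  have hT0 : 0 ≤ T := (one_div_pos.2 (hδpos 0)).le.trans (hT 0)
  have hinc : ∀ k, ‖(1 / δ k) • (grad h (x (k + 1)) - grad h (x k))‖ ≤
      T * Ch * ‖x (k + 1) - x k‖ := fun k => by
    rw [norm_smul, Real.norm_eq_abs, abs_of_pos (one_div_pos.2 (hδpos k)), mul_assoc]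
    exact mul_le_mul (hT k) (hlipH _ (hxball _) _ (hxball _)) (norm_nonneg _) hT0
  have herr : ∀ k, ‖(m k - μ) • (p (k + 1) - p k)‖ ≤ (m k - μ) * (P + P) := fun k => by
    rw [norm_smul, Real.norm_eq_abs, abs_of_nonneg (sub_nonneg.2 (hm k))]
    exact mul_le_mul_of_nonneg_left ((norm_sub_le _ _).trans (add_le_add (hpP _) (hpP _)))
      (sub_nonneg.2 (hm k))
  -- The optimality condition with `m k` replaced by `μ`; the replacement error is summable because
  -- the `p k` are bounded.
  have hkey : ∀ k, (β + μ) • p (k + 1) - μ • p k =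
      -grad E (x k) - (1 / δ k) • (grad h (x (k + 1)) - grad h (x k))
        - (m k - μ) • (p (k + 1) - p k) := fun k => by
    have h1 : (β + μ) • p (k + 1) - μ • p k =
        (m k + β) • p (k + 1) - m k • p k - (m k - μ) • (p (k + 1) - p k) := by module
    rw [h1, hupd k]
    abel
  have hwb : ∀ k, ‖grad E (x (k + 1)) + (β + μ) • p (k + 1) - μ • p k‖ ≤
      (CE + T * Ch) * ‖x (k + 1) - x k‖ + (m k - μ) * (P + P) := fun k => by
    have h1 : grad E (x (k + 1)) + (β + μ) • p (k + 1) - μ • p k =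
        (grad E (x (k + 1)) - grad E (x k))
          - (1 / δ k) • (grad h (x (k + 1)) - grad h (x k))
          - (m k - μ) • (p (k + 1) - p k) := by
      rw [add_sub_assoc, hkey k]
      abel
    rw [h1]
    have h2 := hlipE _ (hxball (k + 1)) _ (hxball k)
    refine (norm_sub_le _ _).trans ?_
    refine (add_le_add (norm_sub_le _ _) le_rfl).trans ?_
    linarith [hinc k, herr k]
  -- finite length
  obtain ⟨lb, -, hlb⟩ := EReal.lt_iff_exists_real_btwn.1 hbasic.bddBelow
  have hlb' : ∀ z, lb ≤ realPart E z + β * realPart R z := fun z => by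
    have h1 := hlb.le.trans (iInf₂_le z (by rw [hdomh]; trivial))
    rw [objective_eq hE hR] at h1
    exact_mod_cast h1
  have hsumm : Summable fun k => ‖x (k + 1) - x k‖ :=
    summable_of_surrogate hE hR hEdiff hRcont hβ hμ hA (by positivity) hp hxM hpP hm hlb' hdec
      (fun k => mul_nonneg (sub_nonneg.2 (hm k)) (by positivity)) (hsum.mul_right (P + P)) hwb hKL
  refine ⟨hsumm, ?_⟩
  have : CompleteSpace X := FiniteDimensional.complete ℝ X
  obtain ⟨xs, hxs⟩ := cauchySeq_tendsto_of_complete (cauchySeq_of_summable_dist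
    (f := x) (by simpa only [dist_eq_norm, norm_sub_rev (x _) (x (Nat.succ _))] using hsumm))
  -- the limiting optimality relation
  have hxsball : xs ∈ Metric.closedBall (0 : X) M :=
    Metric.isClosed_closedBall.mem_of_tendsto hxs (Eventually.of_forall hxball)
  have hgE : Tendsto (fun k => grad E (x k)) atTop (𝓝 (grad E xs)) := by
    rw [tendsto_iff_norm_sub_tendsto_zero] at hxs ⊢
    refine squeeze_zero (fun k => norm_nonneg _)
      (fun k => hlipE _ (hxball k) _ hxsball) ?_
    simpa using hxs.const_mul CE
  have hlim : Tendsto (fun k => (β + μ) • p (k + 1) - μ • p k) atTop (𝓝 (-grad E xs)) := by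
    have h1 : Tendsto (fun k => (1 / δ k) • (grad h (x (k + 1)) - grad h (x k))) atTop (𝓝 0) :=
      squeeze_zero_norm hinc (by simpa using hsumm.tendsto_atTop_zero.const_mul (T * Ch))
    have h2 : Tendsto (fun k => (m k - μ) • (p (k + 1) - p k)) atTop (𝓝 0) :=
      squeeze_zero_norm herr (by simpa using hsum.tendsto_atTop_zero.mul_const (P + P))
    simp only [hkey]
    simpa using (hgE.neg.sub h1).sub h2
  refine ⟨xs, Set.mem_univ _, hxs, fun hβ0 => ?_, fun hlsc => ?_⟩
  · subst hβ0
    -- For `β = 0` the limiting relation describes the increments of the bounded sequence `p`.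
    have h1 : Tendsto (fun k => p (k + 1) - p k) atTop (𝓝 (μ⁻¹ • -grad E xs)) := by
      refine (hlim.const_smul μ⁻¹).congr fun k => ?_
      rw [zero_add, ← smul_sub, inv_smul_smul₀ hμ.ne']
    have h2 := eq_zero_of_tendsto_sub_of_bounded hpP h1
    rcases smul_eq_zero.1 h2 with h3 | h3
    · exact absurd h3 (inv_ne_zero hμ.ne')
    · exact neg_eq_zero.1 h3
  · obtain ⟨ps, hps, hpt⟩ := exists_tendsto_of_subdiff_subsingleton hR hRcont hxs hp hpP
      (subdiff_subsingleton hR hlsc xs)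
    refine ⟨⟨ps, hpt⟩, ps, hps, ?_⟩
    -- Once `p` converges to `ps`, the same combination tends to `β • ps`, and uniqueness of limits
    -- gives stationarity.
    have h1 := ((hpt.comp (tendsto_add_atTop_nat 1)).const_smul (β + μ)).sub (hpt.const_smul μ)
    have h2 := tendsto_nhds_unique h1 hlim
    rw [add_smul, add_sub_cancel_right] at h2
    rw [h2, add_neg_cancel]
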